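/- A clutter $\mathcal{C}$ is a family of subsets (the members) of a finite ground set $V$, none of which contains another. A cover is a subset of $V$ that intersects every member; the covering number is the minimum cardinality of a cover; the blocker $b(\mathcal{C})$ is the clutter over $V$ of the inclusion-wise minimal covers. For disjoint $I,J\subseteq V$, the minor $\mathcal{C}\setminus I/J$ is the clutter over $V-(I\cup J)$ whose members are the inclusion-wise minimal sets in $\{C-J : C\in\mathcal{C},\ C\cap I=\emptyset\}$. A delta is a clutter over a ground set $\{a_1,\ldots,a_n\}$ with $n\ge 3$ whose members are $\{a_2,\ldots,a_n\}$ and $\{a_1,a_i\}$, $i=2,\ldots,n$. An extended odd hole is a clutter over a ground set $\{a_1,\ldots,a_n\}$ with $n\geq 5$ odd whose minimum cardinality members are exactly $\{a_1,a_2\},\{a_2,a_3\},\ldots,\{a_{n-1},a_n\},\{a_n,a_1\}$. A clutter is clean if no minor of it is a delta or the blocker of an extended odd hole. It is tangled if its covering number is two and every element belongs to a minimum cover. For a clean tangled clutter $\mathcal{C}$, $G(\mathcal{C})$ is the graph on $V$ whose edges are the minimum covers (this graph is bipartite), and the rank of $\mathcal{C}$ is the number of connected components of $G(\mathcal{C})$.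 Let $$\mathbb{L}_7=\{\{1,2,3\},\{1,4,5\},\{1,6,7\},\{2,5,6\},\{2,4,7\},\{3,4,6\},\{3,5,7\}\},$$ the clutter over $\{1,\ldots,7\}$ of the lines of the Fano plane. **Lemma.** Let $\mathcal{C}$ be a clean tangled clutter such that: (a) $\mathcal{C}$ has rank $7$, and for each $i\in\{1,\ldots,7\}$, the $i$-th connected component of $G(\mathcal{C})$ (in some fixed ordering of the components) has bipartition $\{U_i,V_i\}$; (b) for each $L\in\mathbb{L}_7$, the set $\bigcup_{i\notin L}U_i\cup\bigcup_{j\in L}V_j$ contains a member of $\mathcal{C}$; (c) for all $L\in\mathbb{L}_7$ but at most one, $\bigcup_{j\in L}V_j$ is a cover of $\mathcal{C}$. Then $\mathcal{C}$ has an $\mathbb{L}_7$ minor, that is, a minor that equals $\mathbb{L}_7$ up to relabeling the elements. -/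

import Mathlib

/-- A clutter: a family of subsets of a finite ground set, none of which contains another one. -/
@[ext]
structure Clutter (α : Type*) where
  /-- the finite ground set -/
  ground : Finset α
  /-- the members -/
  members : Finset (Finset α)
  subset_ground : ∀ M ∈ members, M ⊆ ground
  antichain : IsAntichain (· ⊆ ·) (members : Set (Finset α))

namespace Clutter

variable {α : Type*} [DecidableEq α]

/-- A cover is a subset of the ground set that intersects every member. -/
def IsCover (C : Clutter α) (B : Finset α) : Prop :=
  B ⊆ C.ground ∧ ∀ M ∈ C.members, (B ∩ M).Nonempty

/-- A cover of minimum cardinality. -/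
def IsMinimumCover (C : Clutter α) (B : Finset α) : Prop :=
  C.IsCover B ∧ ∀ B' : Finset α, C.IsCover B' → B.card ≤ B'.card

/-- The covering number, the minimum cardinality of a cover (infinite if there is no cover,
that is, if the empty set is a member). -/
noncomputable def coveringNumber (C : Clutter α) : ℕ∞ :=
  ⨅ B : {B : Finset α // C.IsCover B}, (B.1.card : ℕ∞)

open Classical in
/-- The blocker: the clutter of the inclusion-wise minimal covers, over the same ground set. -/
noncomputable def blocker (C : Clutter α) : Clutter α where
  ground := C.ground
  members := C.ground.powerset.filter (fun B => Minimal C.IsCover B)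
  subset_ground := by
    intro M hM
    simp only [Finset.mem_filter, Finset.mem_powerset] at hM
    exact hM.1
  antichain := by
    intro A hA B hB hne hAB
    simp only [Finset.coe_filter, Finset.mem_powerset, Set.mem_ofPred_eq] at hA hB
    exact hne (Finset.Subset.antisymm hAB (hB.2.2 hA.2.1 hAB))

/-- The family of the sets `M - J`, for the members `M` disjoint from `I`. -/
def preMinor (C : Clutter α) (I J : Finset α) : Finset (Finset α) :=
  (C.members.filter (fun M => Disjoint M I)).image (fun M => M \ J)

open Classical in
/-- The clutter obtained by deleting `I` and contracting `J`: its members are the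
inclusion-wise minimal sets of the form `M - J`, for the members `M` disjoint from `I`. -/
noncomputable def minor (C : Clutter α) (I J : Finset α) : Clutter α where
  ground := C.ground \ (I ∪ J)
  members := (C.preMinor I J).filter (fun M => Minimal (· ∈ C.preMinor I J) M)
  subset_ground := by
    intro M hM x hx
    have h := (Finset.mem_filter.1 hM).1
    simp only [preMinor, Finset.mem_image, Finset.mem_filter] at h
    obtain ⟨N, ⟨hN, hNI⟩, rfl⟩ := h
    rw [Finset.mem_sdiff] at hx
    rw [Finset.mem_sdiff, Finset.mem_union, not_or]
    exact ⟨C.subset_ground N hN hx.1, Finset.disjoint_left.1 hNI hx.1, hx.2⟩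
  antichain := by
    intro A hA B hB hne hAB
    simp only [Finset.coe_filter, Set.mem_ofPred_eq] at hA hB
    exact hne (Finset.Subset.antisymm hAB (hB.2.2 hA.1 hAB))

/-- `D` is a minor of `C`. -/
def IsMinor (D C : Clutter α) : Prop :=
  ∃ I J : Finset α, I ⊆ C.ground ∧ J ⊆ C.ground ∧ Disjoint I J ∧ D = C.minor I J

/-- Two clutters are isomorphic if one is obtained from the other by relabeling the elements
of the ground set. -/
def Isomorphic {β : Type*} [DecidableEq β] (C : Clutter α) (D : Clutter β) : Prop :=
  ∃ f : α → β, Set.InjOn f C.ground ∧ D.ground = C.ground.image f ∧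
    D.members = C.members.image (fun M => M.image f)

/-- A delta: the ground set has at least three elements `a = a₁, a₂, …, aₙ`, and the members
are `{a₂, …, aₙ}` and `{a₁, aᵢ}` for `i = 2, …, n`. -/
def IsDelta (C : Clutter α) : Prop :=
  3 ≤ C.ground.card ∧ ∃ a ∈ C.ground,
    C.members = insert (C.ground.erase a) ((C.ground.erase a).image (fun x => {a, x}))

/-- An extended odd hole: the ground set `{a₁, …, aₙ}` has odd cardinality `n ≥ 5`, and the
members of minimum cardinality are `{a₁, a₂}, {a₂, a₃}, …, {aₙ, a₁}` (the elements are indexed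
cyclically, by the integers modulo `n`). -/
def IsExtendedOddHole (C : Clutter α) : Prop :=
  ∃ (n : ℕ) (a : ZMod n → α), 5 ≤ n ∧ Odd n ∧ Function.Injective a ∧
    (C.ground : Set α) = Set.range a ∧
    ∀ M : Finset α, (M ∈ C.members ∧ ∀ M' ∈ C.members, M.card ≤ M'.card) ↔
      ∃ i : ZMod n, M = {a i, a (i + 1)}

/-- A clutter is clean if no minor of it is a delta or the blocker of an extended odd hole. -/
def IsClean (C : Clutter α) : Prop :=
  ∀ D : Clutter α, D.IsMinor C →
    ¬ D.IsDelta ∧ ¬ ∃ H : Clutter α, H.IsExtendedOddHole ∧ D = H.blocker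

/-- A clutter is tangled if its covering number is two and every element belongs to a minimum
cover. -/
def IsTangled (C : Clutter α) : Prop :=
  C.coveringNumber = 2 ∧ ∀ v ∈ C.ground, ∃ B : Finset α, C.IsMinimumCover B ∧ v ∈ B

/-- The graph `G(C)` on the ground set of `C`, whose edges are the minimum covers
(for a tangled clutter, these have cardinality two). -/
def coverGraph (C : Clutter α) : SimpleGraph {x : α // x ∈ C.ground} where
  Adj u v := u ≠ v ∧ C.IsMinimumCover {u.1, v.1}
  symm := ⟨fun u v h => ⟨h.1.symm, by rw [Finset.pair_comm]; exact h.2⟩⟩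
  loopless := ⟨fun _ h => h.1 rfl⟩

/-- The rank: the number of connected components of `G(C)`. -/
noncomputable def rank (C : Clutter α) : ℕ := Nat.card C.coverGraph.ConnectedComponent

/-- `{U, W}` is the bipartition of the connected component `c` of `G(C)`: the sets `U` and `W`
partition the vertex set of `c`, and every edge of `c` joins `U` and `W`. -/
def IsComponentBipartition (C : Clutter α) (c : C.coverGraph.ConnectedComponent)
    (U W : Finset α) : Prop :=
  Disjoint U W ∧ ((U ∪ W : Finset α) : Set α) = Subtype.val '' c.supp ∧
    ∀ u v : {x : α // x ∈ C.ground}, u ∈ c.supp → C.coverGraph.Adj u v →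
      (u.1 ∈ U ∧ v.1 ∈ W) ∨ (u.1 ∈ W ∧ v.1 ∈ U)

/-- The seven lines of the Fano plane; the points `1, …, 7` are written `0, …, 6`. -/
def fanoLines : Finset (Finset (Fin 7)) :=
  {{0, 1, 2}, {0, 3, 4}, {0, 5, 6}, {1, 4, 5}, {1, 3, 6}, {2, 3, 5}, {2, 4, 6}}

set_option maxRecDepth 20000 in
/-- The clutter `𝕃₇` of the lines of the Fano plane. -/
def L7 : Clutter (Fin 7) where
  ground := Finset.univ
  members := fanoLines
  subset_ground := fun _ _ => Finset.subset_univ _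
  antichain := by
    have h : ∀ A ∈ fanoLines, ∀ B ∈ fanoLines, A ≠ B → ¬ A ⊆ B := by decide
    intro A hA B hB hne
    exact h A hA B hB hne

/-- `C` has an `𝕃₇` minor, that is, a minor isomorphic to `𝕃₇`. -/
def HasL7Minor (C : Clutter α) : Prop :=
  ∃ D : Clutter α, D.IsMinor C ∧ L7.Isomorphic D

end Clutter

namespace Clutter

/-! The argument runs in the blocker: the object studied is the up-closed family of sets meeting
every member. As deltas are self-blocking, cleanness says that the minimal sets of this family have
no delta minor and no extended odd hole minor (`CleanFamily`). Contracting `T` turns `P` into `fun S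
=> P (S ∪ T)` and preserves the hypothesis.

On a set of elements none of which is a singleton of the family, the graph of pairs is then
bipartite, and no set of the family lies in one side of one component (`not_of_evenConnected`).
Hence two one-sided sets whose union is in the family lie in opposite sides of the same component
(`oddConnected_of_union`).

In the Fano configuration this yields a parity contradiction (`exists_of_config`): after contracting
parts of `V a` and `V p`, suitable line covers force odd and even walks between the same vertices,
unless an element completes the third point of the line through `a` and `p`. Used with whole sets `V
i`, it supplies the missing line cover and shrinks each `V p` to one element `v p` that works for
all lines through `p`; used with single elements, it shows that `v` sends every line to a cover.
Contracting everything outside the image of `v` leaves `L7`, because the Fano lines are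
self-blocking and hypothesis (b) bounds the members from above. -/

theorem exists_minimal_subset {α : Type*} {P : Finset α → Prop} {X : Finset α} (hX : P X) :
    ∃ Y ⊆ X, P Y ∧ ∀ S, S ⊂ Y → ¬ P S := by
  induction X using Finset.strongInduction with
  | H X ih =>
    by_cases h : ∀ S, S ⊂ X → ¬ P S
    · exact ⟨X, subset_rfl, hX, h⟩
    · push Not at h
      obtain ⟨S, hS, hPS⟩ := h
      obtain ⟨Y, hYS, hY⟩ := ih S hS hPS
      exact ⟨Y, hYS.trans hS.1, hY⟩

variable {α : Type*} [DecidableEq α]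

/-! ### Clean families and their contractions -/

/-- A family of sets, closed under taking supersets, whose inclusion-wise minimal sets form a
clutter without a delta minor and without an extended odd hole minor. -/
structure CleanFamily (P : Finset α → Prop) : Prop where
  mono : ∀ S T : Finset α, S ⊆ T → P S → P T
  no_delta : ∀ (T B : Finset α) (u : α), u ∉ B → 2 ≤ B.card →
    (∀ b ∈ B, P ({u, b} ∪ T)) → P (B ∪ T) → (∀ S, S ⊂ B → ¬ P (S ∪ T)) → ¬ P ({u} ∪ T) → False
  no_hole : ∀ (T : Finset α) (n : ℕ) (a : ZMod n → α), 5 ≤ n → Odd n → Function.Injective a →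
    (∀ i, P ({a i, a (i + 1)} ∪ T)) →
    (∀ i j, P ({a i, a j} ∪ T) → ∃ k, ({a i, a j} : Finset α) = {a k, a (k + 1)}) → False

theorem CleanFamily.contract {P : Finset α → Prop} (h : CleanFamily P) (T : Finset α) :
    CleanFamily (fun S => P (S ∪ T)) where
  mono S S' hS := h.mono _ _ (Finset.union_subset_union_left hS)
  no_delta T' B u := by
    simpa only [Finset.union_assoc] using h.no_delta (T' ∪ T) B u
  no_hole T' n a := by
    simpa only [Finset.union_assoc] using h.no_hole (T' ∪ T) n a

/-- A minimal set of a clean family does not contain two neighbours of an element outside. -/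
theorem CleanFamily.no_common_neighbour {P : Finset α → Prop} (h : CleanFamily P) {u v w : α}
    {B : Finset α} (hu : u ∉ B) (hv : v ∈ B) (hw : w ∈ B) (hvw : v ≠ w) (huv : P {u, v})
    (huw : P {u, w}) (hB : P B) (hmin : ∀ S, S ⊂ B → ¬ P S) (hsingle : ¬ P {u}) : False := by
  induction hn : B.card generalizing B P with
  | zero => simp_all
  | succ n ih =>
    by_cases hall : ∀ b ∈ B, P {u, b}
    · refine h.no_delta ∅ B u hu ?_ (by simpa using hall) (by simpa using hB)
        (by simpa using hmin) (by simpa using hsingle)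
      exact Finset.one_lt_card.2 ⟨v, hv, w, hw, hvw⟩
    · push Not at hall
      obtain ⟨t, ht, hut⟩ := hall
      have htv : v ≠ t := by rintro rfl; exact hut huv
      have htw : w ≠ t := by rintro rfl; exact hut huw
      -- Contracting a non-neighbour `t` of `u` keeps the rest of `B` minimal, and `¬ P {u, t}`
      -- becomes the statement that `u` is still not a singleton. Once only neighbours remain, they
      -- form a delta with `u`.
      refine ih (h.contract {t}) (B := B.erase t) (by simp [hu]) (by simp [hv, htv])
        (by simp [hw, htw]) (h.mono _ _ Finset.subset_union_left huv)
        (h.mono _ _ Finset.subset_union_left huw) ?_ ?_ ?_ ?_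
      · refine h.mono _ _ ?_ hB
        intro x hx
        by_cases hxt : x = t <;> simp [hx, hxt]
      · intro S hS
        refine hmin _ ?_
        rw [Finset.ssubset_iff_subset_ne] at hS ⊢
        refine ⟨Finset.union_subset (hS.1.trans (Finset.erase_subset _ _)) (by simpa using ht), ?_⟩
        rintro rfl
        apply hS.2
        have : t ∉ S := fun h' => by simpa using hS.1 h'
        ext x
        have := ne_of_mem_of_not_mem (a := t) (s := S) (b := x)
        grind
      · simpa [← Finset.insert_eq] using hut
      · rw [Finset.card_erase_of_mem ht, hn]; rfl

/-! ### Parity of walks and bipartiteness of the graph of pairs -/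

/-- The graph on `R` whose edges are the pairs that belong to the family. -/
def pairGraph (P : Finset α → Prop) (R : Set α) : SimpleGraph α where
  Adj u v := u ≠ v ∧ u ∈ R ∧ v ∈ R ∧ P {u, v}
  symm := ⟨fun u v h => ⟨h.1.symm, h.2.2.1, h.2.1, by rw [Finset.pair_comm]; exact h.2.2.2⟩⟩
  loopless := ⟨fun _ h => h.1 rfl⟩

/-- There is a walk of even length from `u` to `v`. -/
def EvenConnected {β : Type*} (G : SimpleGraph β) (u v : β) : Prop :=
  ∃ w : G.Walk u v, Even w.length

/-- There is a walk of odd length from `u` to `v`. -/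
def OddConnected {β : Type*} (G : SimpleGraph β) (u v : β) : Prop :=
  ∃ w : G.Walk u v, Odd w.length

section Walks

variable {β : Type*} {G : SimpleGraph β} {u v w : β}

theorem EvenConnected.symm (h : EvenConnected G u v) : EvenConnected G v u := by
  obtain ⟨p, hp⟩ := h
  exact ⟨p.reverse, by simpa using hp⟩

theorem OddConnected.symm (h : OddConnected G u v) : OddConnected G v u := by
  obtain ⟨p, hp⟩ := h
  exact ⟨p.reverse, by simpa using hp⟩

theorem EvenConnected.trans (h : EvenConnected G u v) (h' : EvenConnected G v w) :
    EvenConnected G u w := by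
  obtain ⟨p, hp⟩ := h
  obtain ⟨q, hq⟩ := h'
  exact ⟨p.append q, by rw [SimpleGraph.Walk.length_append]; exact hp.add hq⟩

theorem EvenConnected.trans_odd (h : EvenConnected G u v) (h' : OddConnected G v w) :
    OddConnected G u w := by
  obtain ⟨p, hp⟩ := h
  obtain ⟨q, hq⟩ := h'
  exact ⟨p.append q, by rw [SimpleGraph.Walk.length_append]; exact hp.add_odd hq⟩

theorem OddConnected.trans (h : OddConnected G u v) (h' : OddConnected G v w) :
    EvenConnected G u w := by
  obtain ⟨p, hp⟩ := h
  obtain ⟨q, hq⟩ := h'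
  exact ⟨p.append q, by rw [SimpleGraph.Walk.length_append]; exact hp.add_odd hq⟩

theorem OddConnected.of_adj (h : G.Adj u v) : OddConnected G u v := ⟨.cons h .nil, by simp⟩

theorem EvenConnected.of_walk {H : SimpleGraph β} (p : G.Walk u v) (hp : Even p.length)
    (h : ∀ s ∈ p.support, ∀ t ∈ p.support, G.Adj s t → H.Adj s t) : EvenConnected H u v := by
  refine ⟨p.transfer H ?_, by rwa [SimpleGraph.Walk.length_transfer]⟩
  intro e he
  induction e using Sym2.ind with
  | _ s t =>
    exact h s (p.fst_mem_support_of_mem_edges he) t (p.snd_mem_support_of_mem_edges he)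
      (p.adj_of_mem_edges he)

theorem EvenConnected.refl (u : β) : EvenConnected G u u := ⟨.nil, by simp⟩

/-- A shortest closed walk of odd length is an induced odd cycle. -/
theorem exists_induced_odd_cycle (h : OddConnected G u u) :
    ∃ (n : ℕ) (f : ℕ → β), Odd n ∧ f n = f 0 ∧ (∀ i, i < n → G.Adj (f i) (f (i + 1))) ∧
      (∀ i j, i < j → j < n → f i ≠ f j) ∧
      ∀ i j, i < j → j < n → G.Adj (f i) (f j) → j = i + 1 ∨ i = 0 ∧ j + 1 = n := by
  classical
  have hex : ∃ n, Odd n ∧ ∃ (x : β) (p : G.Walk x x), p.length = n := by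
    obtain ⟨p, hp⟩ := h
    exact ⟨_, hp, u, p, rfl⟩
  obtain ⟨hodd, x, p, hp⟩ := Nat.find_spec hex
  have hmin : ∀ (y : β) (q : G.Walk y y), Odd q.length → Nat.find hex ≤ q.length :=
    fun y q hq => Nat.find_min' hex ⟨hq, y, q, rfl⟩
  set n := Nat.find hex
  have seg : ∀ i j, i ≤ j → j ≤ n →
      ∃ q : G.Walk (p.getVert i) (p.getVert j), q.length = j - i := by
    intro i j hij hj
    refine ⟨((p.drop i).take (j - i)).copy rfl ?_, ?_⟩
    · rw [SimpleGraph.Walk.drop_getVert]; congr 1; omega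
    · simp [SimpleGraph.Walk.take_length, SimpleGraph.Walk.drop_length]; omega
  have h0 : p.getVert n = p.getVert 0 := by simp [← hp]
  have around : ∀ i j, i ≤ j → j ≤ n →
      ∃ q : G.Walk (p.getVert j) (p.getVert i), q.length = n - (j - i) := by
    intro i j hij hj
    obtain ⟨q, hq⟩ := seg j n hj le_rfl
    obtain ⟨r, hr⟩ := seg 0 i (Nat.zero_le _) (hij.trans hj)
    refine ⟨q.append (r.copy h0.symm rfl), ?_⟩
    simp [hq, hr]; omega
  refine ⟨n, p.getVert, hodd, h0, fun i hi => p.adj_getVert_succ (hp.symm ▸ hi), ?_, ?_⟩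
  -- A repeated vertex splits the closed walk into two closed walks whose lengths sum to the odd
  -- number `n`; the odd one is too short.
  · intro i j hij hj heq
    obtain ⟨q, hq⟩ := seg i j hij.le hj.le
    obtain ⟨r, hr⟩ := around i j hij.le hj.le
    have h1 := hmin _ (q.copy rfl heq.symm)
    have h2 := hmin _ (r.copy rfl heq)
    simp only [SimpleGraph.Walk.length_copy, hq, hr] at h1 h2
    grind
  -- A chord closes both arcs, with lengths summing to `n + 2`. The odd one has length at least `n`,
  -- so the other arc is a single edge.
  · intro i j hij hj hadj
    obtain ⟨q, hq⟩ := seg i j hij.le hj.le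
    obtain ⟨r, hr⟩ := around i j hij.le hj.le
    have h1 := hmin _ (q.append (.cons hadj.symm .nil))
    have h2 := hmin _ (r.append (.cons hadj .nil))
    simp only [SimpleGraph.Walk.length_append, SimpleGraph.Walk.length_cons,
      SimpleGraph.Walk.length_nil, hq, hr] at h1 h2
    grind

end Walks

theorem CleanFamily.not_oddConnected_self {P : Finset α → Prop} (h : CleanFamily P) {R : Set α}
    (hR : ∀ z ∈ R, ¬ P {z}) (x : α) : ¬ OddConnected (pairGraph P R) x x := by
  intro hx
  obtain ⟨n, f, hodd, h0, hadj, hinj, hchord⟩ := exists_induced_odd_cycle hx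
  have hne1 : n ≠ 1 := by
    rintro rfl
    have := hadj 0 one_pos
    rw [zero_add, h0] at this
    exact this.1 rfl
  have hn3 : n = 3 ∨ 5 ≤ n := by grind
  rcases hn3 with rfl | hn
  · have h01 := hadj 0 (by norm_num)
    have h12 := hadj 1 (by norm_num)
    have h20 := hadj 2 (by norm_num)
    norm_num at h01 h12 h20
    rw [h0] at h20
    refine h.no_common_neighbour (u := f 0) (v := f 1) (w := f 2) (B := {f 1, f 2})
      ?_ (by simp) (by simp) h12.1 h01.2.2.2 h20.symm.2.2.2 h12.2.2.2 ?_ (hR _ h01.2.1)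
    · simp [h01.1, h20.1.symm]
    · intro S hS hPS
      have hcard := Finset.card_lt_card hS
      rw [Finset.card_pair h12.1] at hcard
      have : Nonempty α := ⟨x⟩
      have : S ⊆ {f 1} ∨ S ⊆ {f 2} := by
        rcases Finset.card_le_one_iff_subset_singleton.1 (Nat.lt_succ_iff.1 hcard) with ⟨y, hy⟩
        rcases S.eq_empty_or_nonempty with rfl | ⟨z, hz⟩
        · simp
        · have h1 := hS.1 hz
          have h2 := hy hz
          simp only [Finset.mem_insert, Finset.mem_singleton] at h1 h2
          subst h2
          rcases h1 with rfl | rfl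
          · exact Or.inl hy
          · exact Or.inr hy
      rcases this with h' | h'
      · exact hR _ h12.2.1 (h.mono _ _ h' hPS)
      · exact hR _ h12.2.2.1 (h.mono _ _ h' hPS)
  · have : NeZero n := ⟨by omega⟩
    have : Fact (1 < n) := ⟨by omega⟩
    have hsucc : ∀ i : ZMod n, f (i + 1).val = f (i.val + 1) := by
      intro i
      rcases Nat.lt_or_ge (i.val + 1) n with hi | hi
      · rw [ZMod.val_add_of_lt (by rwa [ZMod.val_one]), ZMod.val_one]
      · have hi' : i.val + 1 = n := le_antisymm (ZMod.val_lt i) hi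
        have : (i + 1).val = 0 := by
          rw [ZMod.val_add, ZMod.val_one, hi', Nat.mod_self]
        rw [this, hi', h0]
    have hvert : ∀ i : ZMod n, f i.val ∈ R := fun i => (hadj _ (ZMod.val_lt i)).2.1
    have hcons : ∀ i j : ZMod n, i.val < j.val → P {f i.val, f j.val} →
        j = i + 1 ∨ i = j + 1 := by
      intro i j hij hP
      have hadj' : (pairGraph P R).Adj (f i.val) (f j.val) :=
        ⟨hinj _ _ hij (ZMod.val_lt j), hvert i, hvert j, hP⟩
      rcases hchord _ _ hij (ZMod.val_lt j) hadj' with h' | ⟨hi, hj⟩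
      · left
        apply ZMod.val_injective
        rw [ZMod.val_add_of_lt (by rw [ZMod.val_one, ← h']; exact ZMod.val_lt j), ZMod.val_one, h']
      · right
        apply ZMod.val_injective
        rw [ZMod.val_add, ZMod.val_one, hj, Nat.mod_self, hi]
    refine h.no_hole ∅ n (fun i => f i.val) hn hodd ?_ ?_ ?_
    · intro i j hij
      apply ZMod.val_injective
      by_contra hne
      rcases Nat.lt_or_gt_of_ne hne with h' | h'
      · exact hinj _ _ h' (ZMod.val_lt j) hij
      · exact hinj _ _ h' (ZMod.val_lt i) hij.symm
    · intro i
      simp only [Finset.union_empty, hsucc]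
      exact (hadj _ (ZMod.val_lt i)).2.2.2
    · intro i j hP
      rw [Finset.union_empty] at hP
      rcases lt_trichotomy i.val j.val with h' | h' | h'
      · rcases hcons i j h' hP with rfl | rfl
        · exact ⟨i, rfl⟩
        · exact ⟨j, Finset.pair_comm _ _⟩
      · rw [h', Finset.pair_eq_singleton] at hP
        exact absurd hP (hR _ (hvert j))
      · rw [Finset.pair_comm] at hP
        rcases hcons j i h' hP with rfl | rfl
        · exact ⟨j, Finset.pair_comm _ _⟩
        · exact ⟨i, rfl⟩

theorem CleanFamily.not_evenConnected_of_oddConnected {P : Finset α → Prop} (h : CleanFamily P)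
    {R : Set α} (hR : ∀ z ∈ R, ¬ P {z}) {x y : α} (he : EvenConnected (pairGraph P R) x y)
    (ho : OddConnected (pairGraph P R) x y) : False :=
  h.not_oddConnected_self hR x (he.trans_odd ho.symm)

/-! ### Sets of the family and sides of components -/

/-- A set contained in one side of a component of the graph of pairs is not in the family. -/
theorem CleanFamily.not_of_evenConnected {P : Finset α → Prop} (h : CleanFamily P) {R : Set α}
    (hR : ∀ z ∈ R, ¬ P {z}) {X : Finset α} (hXR : ∀ x ∈ X, x ∈ R) (hX0 : X.Nonempty) {b : α}
    (hX : ∀ x ∈ X, EvenConnected (pairGraph P R) b x) : ¬ P X := by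
  induction hn : X.card using Nat.strong_induction_on generalizing P R X with
  | _ n ih =>
  intro hPX
  obtain ⟨Y, hYX, hY, hYmin⟩ := exists_minimal_subset hPX
  have hYR : ∀ y ∈ Y, y ∈ R := fun y hy => hXR y (hYX hy)
  have hYE : ∀ y ∈ Y, EvenConnected (pairGraph P R) b y := fun y hy => hX y (hYX hy)
  have hempty : ¬ P ∅ := by
    obtain ⟨x, hx⟩ := hX0
    exact fun h' => hR x (hXR x hx) (h.mono _ _ (Finset.empty_subset _) h')
  have hY0 : Y.Nonempty := by
    rw [Finset.nonempty_iff_ne_empty]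
    rintro rfl
    exact hempty hY
  have hnoadj : ∀ x ∈ Y, ∀ y ∈ Y, x ≠ y → ¬ P {x, y} := by
    intro x hx y hy hxy hP
    refine h.not_evenConnected_of_oddConnected hR ((hYE x hx).symm.trans (hYE y hy))
      (.of_adj ⟨hxy, hYR x hx, hYR y hy, hP⟩)
  have hnocommon : ∀ u ∈ R, ∀ x ∈ Y, ∀ y ∈ Y, x ≠ y → P {u, x} → P {u, y} → False := by
    intro u hu x hx y hy hxy hux huy
    by_cases huY : u ∈ Y
    · rcases eq_or_ne u x with rfl | hne
      · exact hnoadj u hx y hy hxy huy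
      · exact hnoadj u huY x hx hne hux
    · exact h.no_common_neighbour huY hx hy hxy hux huy hY hYmin (hR u hu)
  -- The element to contract is one farthest from `b`, so that geodesics to the other elements of
  -- `Y` survive the loss of the neighbours of `x`.
  obtain ⟨x, hx, hmax⟩ := Y.exists_max_image (fun y => (pairGraph P R).dist b y) hY0
  have herase : (Y.erase x).Nonempty := by
    rw [Finset.nonempty_iff_ne_empty]
    intro h'
    have hsub : Y ⊆ {x} := by
      rw [Finset.erase_eq_empty_iff] at h'
      rcases h' with rfl | h'
      · simp
      · exact h'.subset
    exact hR x (hYR x hx) (h.mono _ _ hsub hY)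
  have hR' : ∀ y ∈ Y, y ≠ x → ∀ (p : (pairGraph P R).Walk b y),
      p.length = (pairGraph P R).dist b y → ∀ i ≤ p.length, p.getVert i ∈ R → ¬ P {p.getVert i, x} := by
    intro y hy hyx p hp i hi hmem hP
    have hix : p.getVert i = x ∨ (pairGraph P R).Adj (p.getVert i) x := by
      by_cases hne : p.getVert i = x
      · exact Or.inl hne
      · exact Or.inr ⟨hne, hmem, hYR x hx, hP⟩
    rcases hix with h' | h'
    · rw [h', Finset.pair_eq_singleton] at hP
      exact hR x (hYR x hx) hP
    · have hdist : (pairGraph P R).dist b x ≤ i + 1 := by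
        refine (SimpleGraph.dist_le ((p.take i).append (.cons h' .nil))).trans ?_
        simp [SimpleGraph.Walk.take_length]
      have hyd := hmax y hy
      -- As `x` is farthest, a neighbour of `x` on a geodesic to `y` is `y` itself, giving an edge
      -- inside one side, or the predecessor of `y`, a common neighbour of `x` and `y`.
      rcases (by omega : i = p.length ∨ i + 1 = p.length) with h1 | h1
      · rw [h1, SimpleGraph.Walk.getVert_length] at hP
        exact hnoadj y hy x hx hyx hP
      · have hadj := p.adj_getVert_succ (i := i) (by omega)
        rw [h1, SimpleGraph.Walk.getVert_length] at hadj
        exact hnocommon _ hmem y hy x hx hyx hadj.2.2.2 hP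
  have hreach : ∀ y ∈ Y, y ≠ x → EvenConnected
      (pairGraph (fun S => P (S ∪ {x})) {z | z ∈ R ∧ ¬ P {z, x}}) b y ∧ ¬ P {y, x} := by
    intro y hy hyx
    refine ⟨?_, hnoadj y hy x hx hyx⟩
    have hrch : (pairGraph P R).Reachable b y := (hYE y hy).elim fun p _ => p.reachable
    obtain ⟨p, hp⟩ := hrch.exists_walk_length_eq_dist
    have heven : Even p.length := by
      by_contra hodd
      exact h.not_evenConnected_of_oddConnected hR (hYE y hy) ⟨p, Nat.not_even_iff_odd.1 hodd⟩
    have hp' := hR' y hy hyx p hp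
    refine .of_walk p heven fun s hs t ht hadj => ?_
    rw [SimpleGraph.Walk.mem_support_iff_exists_getVert] at hs ht
    obtain ⟨i, rfl, hi⟩ := hs
    obtain ⟨j, rfl, hj⟩ := ht
    exact ⟨hadj.1, ⟨hadj.2.1, hp' i hi hadj.2.1⟩, ⟨hadj.2.2.1, hp' j hj hadj.2.2.1⟩,
      h.mono _ _ Finset.subset_union_left hadj.2.2.2⟩
  refine ih (Y.erase x).card ?_ (h.contract {x}) (R := {z | z ∈ R ∧ ¬ P {z, x}}) ?_ ?_ herase ?_ rfl ?_
  · rw [← hn]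
    exact (Finset.card_erase_lt_of_mem hx).trans_le (Finset.card_le_card hYX)
  · rintro z ⟨-, hz⟩
    exact hz
  · intro y hy
    rw [Finset.mem_erase] at hy
    exact ⟨hYR y hy.2, (hreach y hy.2 hy.1).2⟩
  · intro y hy
    rw [Finset.mem_erase] at hy
    exact (hreach y hy.2 hy.1).1
  · refine h.mono _ _ ?_ hY
    intro y hy
    by_cases hyx : y = x <;> simp [hy, hyx]

/-- A walk never leaves its component, and contraction only adds pairs to the family. -/
theorem evenConnected_contract_component {P : Finset α → Prop} (h : CleanFamily P) {R : Set α}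
    (T : Finset α) {b y : α} (hy : EvenConnected (pairGraph P R) b y) :
    EvenConnected (pairGraph (fun S => P (S ∪ T)) {z | z ∈ R ∧ (pairGraph P R).Reachable b z})
      b y := by
  obtain ⟨p, hp⟩ := hy
  refine .of_walk p hp fun s hs t ht hadj => ?_
  exact ⟨hadj.1, ⟨hadj.2.1, (p.takeUntil s hs).reachable⟩,
    ⟨hadj.2.2.1, (p.takeUntil t ht).reachable⟩,
    h.mono _ _ Finset.subset_union_left hadj.2.2.2⟩

/-- If a set of the family is the union of two parts, each of them in one side of a component of
the graph of pairs, then the parts are in opposite sides of the same component. -/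
theorem CleanFamily.oddConnected_of_union {P : Finset α → Prop} (h : CleanFamily P) {R : Set α}
    (hR : ∀ z ∈ R, ¬ P {z}) {X Y : Finset α} (hXR : ∀ x ∈ X, x ∈ R) (hYR : ∀ y ∈ Y, y ∈ R)
    (hX0 : X.Nonempty) (hY0 : Y.Nonempty) {b c : α}
    (hX : ∀ x ∈ X, EvenConnected (pairGraph P R) b x)
    (hY : ∀ y ∈ Y, EvenConnected (pairGraph P R) c y) (hXY : P (X ∪ Y)) :
    OddConnected (pairGraph P R) b c := by
  by_contra hodd
  by_cases hreach : (pairGraph P R).Reachable b c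
  · obtain ⟨p⟩ := hreach
    have hbc : EvenConnected (pairGraph P R) b c :=
      ⟨p, Nat.not_odd_iff_even.1 fun h' => hodd ⟨p, h'⟩⟩
    refine h.not_of_evenConnected hR (X := X ∪ Y) ?_ (hX0.mono Finset.subset_union_left) (b := b)
      ?_ hXY
    · intro x hx
      exact (Finset.mem_union.1 hx).elim (hXR x) (hYR x)
    · intro x hx
      exact (Finset.mem_union.1 hx).elim (hX x) fun hy => hbc.trans (hY x hy)
  have hXr : ∀ x ∈ X, (pairGraph P R).Reachable b x := fun x hx => (hX x hx).elim fun p _ => ⟨p⟩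
  have hYr : ∀ x ∈ Y, (pairGraph P R).Reachable c x := fun x hx => (hY x hx).elim fun p _ => ⟨p⟩
  -- In distinct components, either contracting some such `s` creates no singleton in the component
  -- of `c` (that would be an edge between the components), or contracting `Y` creates none in the
  -- component of `b`. The remaining set is then one-sided and in the contracted family.
  by_cases hs : ∃ s ∈ R, (pairGraph P R).Reachable b s ∧ P ({s} ∪ Y)
  · obtain ⟨s, hsR, hbs, hPs⟩ := hs
    refine (h.contract {s}).not_of_evenConnected
      (R := {z | z ∈ R ∧ (pairGraph P R).Reachable c z}) ?_ (fun y hy => ⟨hYR y hy, hYr y hy⟩) hY0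
      (fun y hy => evenConnected_contract_component h {s} (hY y hy)) (by rwa [Finset.union_comm])
    rintro z ⟨hzR, hcz⟩ hP
    have hne : s ≠ z := by
      rintro rfl
      exact hreach (hbs.trans hcz.symm)
    have hadj : (pairGraph P R).Adj s z :=
      ⟨hne, hsR, hzR, by rwa [Finset.pair_comm]⟩
    exact hreach (hbs.trans (hadj.reachable.trans hcz.symm))
  · push Not at hs
    refine (h.contract Y).not_of_evenConnected
      (R := {z | z ∈ R ∧ (pairGraph P R).Reachable b z}) ?_ (fun y hy => ⟨hXR y hy, hXr y hy⟩) hX0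
      (fun y hy => evenConnected_contract_component h Y (hX y hy)) hXY
    rintro z ⟨hzR, hbz⟩
    exact hs z hzR hbz

/-! ### Covers of minors, blockers, and the clean family of a clean clutter -/

/-- The set `S` intersects every member. -/
def Meets (C : Clutter α) (S : Finset α) : Prop := ∀ M ∈ C.members, (S ∩ M).Nonempty

theorem Meets.mono {C : Clutter α} {S T : Finset α} (h : S ⊆ T) (hS : C.Meets S) : C.Meets T :=
  fun M hM => (hS M hM).mono (Finset.inter_subset_inter_right h)

theorem meets_iff_of_inter_ground {C : Clutter α} {S T : Finset α}
    (h : ∀ x ∈ C.ground, x ∈ S ↔ x ∈ T) : C.Meets S ↔ C.Meets T := by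
  refine forall₂_congr fun M hM => ?_
  have : S ∩ M = T ∩ M := by
    ext x
    have := fun hx => h x (C.subset_ground M hM hx)
    simp only [Finset.mem_inter]
    tauto
  rw [this]

theorem isCover_minor_iff {C : Clutter α} {I J S : Finset α} (hS : S ⊆ C.ground \ (I ∪ J)) :
    (C.minor I J).IsCover S ↔ C.Meets (S ∪ I) := by
  have hSJ : ∀ x ∈ S, x ∉ J := fun x hx hxJ =>
    (Finset.mem_sdiff.1 (hS hx)).2 (Finset.mem_union_right _ hxJ)
  constructor
  · rintro ⟨-, h⟩ M hM
    by_cases hMI : Disjoint M I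
    · have hpre : M \ J ∈ C.preMinor I J :=
        Finset.mem_image_of_mem _ (Finset.mem_filter.2 ⟨hM, hMI⟩)
      obtain ⟨N, hNM, hN, hNmin⟩ := exists_minimal_subset (P := (· ∈ C.preMinor I J)) hpre
      have hNmem : N ∈ (C.minor I J).members := by
        simp only [minor, Finset.mem_filter]
        refine ⟨hN, hN, fun S hS hSN => ?_⟩
        by_contra h'
        exact hNmin S ⟨hSN, h'⟩ hS
      obtain ⟨x, hx⟩ := h N hNmem
      rw [Finset.mem_inter] at hx
      exact ⟨x, Finset.mem_inter.2 ⟨Finset.mem_union_left _ hx.1,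
        (Finset.mem_sdiff.1 (hNM hx.2)).1⟩⟩
    · obtain ⟨x, hxM, hxI⟩ := Finset.not_disjoint_iff.1 hMI
      exact ⟨x, Finset.mem_inter.2 ⟨Finset.mem_union_right _ hxI, hxM⟩⟩
  · intro h
    refine ⟨hS, fun N hN => ?_⟩
    simp only [minor, Finset.mem_filter] at hN
    have hN' := hN.1
    simp only [preMinor, Finset.mem_image, Finset.mem_filter] at hN'
    obtain ⟨M, ⟨hM, hMI⟩, rfl⟩ := hN'
    obtain ⟨x, hx⟩ := h M hM
    rw [Finset.mem_inter, Finset.mem_union] at hx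
    rcases hx.1 with hxS | hxI
    · exact ⟨x, Finset.mem_inter.2 ⟨hxS, Finset.mem_sdiff.2 ⟨hx.2, hSJ x hxS⟩⟩⟩
    · exact absurd hxI (Finset.disjoint_left.1 hMI hx.2)

/-- Deletion of `T` in the clutter is contraction of `T` in the blocker, and contracting the rest
confines covers to `X`. `T` may leave the ground set, so only its trace there is deleted. -/
theorem exists_minor_isCover_iff (C : Clutter α) {X T : Finset α} (hX : X ⊆ C.ground)
    (hXT : Disjoint X T) : ∃ D : Clutter α, D.IsMinor C ∧ D.ground = X ∧
      ∀ S ⊆ X, D.IsCover S ↔ C.Meets (S ∪ T) := by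
  have hground : C.ground \ (T ∩ C.ground ∪ C.ground \ (T ∪ X)) = X := by
    ext x
    have := @hX x
    have h' : x ∈ X → x ∉ T := fun h => Finset.disjoint_left.1 hXT h
    simp only [Finset.mem_sdiff, Finset.mem_union, Finset.mem_inter]
    tauto
  refine ⟨C.minor (T ∩ C.ground) (C.ground \ (T ∪ X)), ⟨_, _, Finset.inter_subset_right,
    Finset.sdiff_subset, ?_, rfl⟩, hground, fun S hS => ?_⟩
  · rw [Finset.disjoint_left]
    intro x
    simp only [Finset.mem_sdiff, Finset.mem_union, Finset.mem_inter]
    tauto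
  · rw [isCover_minor_iff (by rwa [hground])]
    refine meets_iff_of_inter_ground fun x hx => ?_
    simp [hx]

theorem mem_blocker_members {C : Clutter α} {B : Finset α} :
    B ∈ C.blocker.members ↔ C.IsCover B ∧ ∀ S ⊂ B, ¬ C.IsCover S := by
  simp only [blocker, Finset.mem_filter, Finset.mem_powerset]
  constructor
  · rintro ⟨-, h⟩
    exact ⟨h.1, fun S hS hSC => hS.2 (h.2 hSC hS.1)⟩
  · rintro ⟨h, hmin⟩
    refine ⟨h.1, h, fun S hS hSB => ?_⟩
    by_contra h'
    exact hmin S ⟨hSB, h'⟩ hS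

theorem isCover_blocker_iff {C : Clutter α} {S : Finset α} :
    C.blocker.IsCover S ↔ S ⊆ C.ground ∧ ∃ M ∈ C.members, M ⊆ S := by
  constructor
  · rintro ⟨hS, h⟩
    refine ⟨hS, ?_⟩
    by_contra! hM
    have hcover : C.IsCover (C.ground \ S) := by
      refine ⟨Finset.sdiff_subset, fun M hMC => ?_⟩
      obtain ⟨x, hxM, hxS⟩ := Finset.not_subset.1 (hM M hMC)
      exact ⟨x, by simp [hxM, hxS, C.subset_ground M hMC hxM]⟩
    obtain ⟨B, hBS, hB, hmin⟩ := exists_minimal_subset hcover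
    obtain ⟨x, hx⟩ := h B (mem_blocker_members.2 ⟨hB, hmin⟩)
    rw [Finset.mem_inter] at hx
    exact (Finset.mem_sdiff.1 (hBS hx.2)).2 hx.1
  · rintro ⟨hS, M, hM, hMS⟩
    refine ⟨hS, fun B hB => ?_⟩
    obtain ⟨x, hx⟩ := (mem_blocker_members.1 hB).1.2 M hM
    rw [Finset.mem_inter] at hx
    exact ⟨x, Finset.mem_inter.2 ⟨hMS hx.2, hx.1⟩⟩

theorem blocker_blocker (C : Clutter α) : C.blocker.blocker = C := by
  refine Clutter.ext rfl (Finset.ext fun B => ?_)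
  rw [mem_blocker_members]
  simp only [isCover_blocker_iff]
  constructor
  · rintro ⟨⟨hB, M, hM, hMB⟩, hmin⟩
    rcases eq_or_ssubset_of_subset hMB with rfl | h
    · exact hM
    · exact absurd ⟨C.subset_ground M hM, M, hM, subset_rfl⟩ (hmin M h)
  · intro hB
    refine ⟨⟨C.subset_ground B hB, B, hB, subset_rfl⟩, ?_⟩
    rintro S hS ⟨-, M, hM, hMS⟩
    have := C.antichain hM hB (fun h => (h ▸ hMS.trans_ssubset hS).ne rfl) (hMS.trans hS.1)
    exact this

/-- The blocker of a delta is a delta. -/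
theorem IsDelta.blocker {C : Clutter α} (h : C.IsDelta) : C.blocker.IsDelta := by
  obtain ⟨hcard, a, ha, hmem⟩ := h
  refine ⟨hcard, a, ha, ?_⟩
  have hcover : ∀ S, C.IsCover S ↔ S ⊆ C.ground ∧
      (C.ground.erase a ⊆ S ∨ ∃ x ∈ C.ground.erase a, {a, x} ⊆ S) := by
    intro S
    refine and_congr_right fun hS => ?_
    rw [hmem]
    simp only [Finset.mem_insert, Finset.mem_image, forall_eq_or_imp, forall_exists_index, and_imp,
      forall_apply_eq_imp_iff₂]
    constructor
    · rintro ⟨⟨x, hx⟩, hall⟩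
      rw [Finset.mem_inter] at hx
      by_cases haS : a ∈ S
      · exact Or.inr ⟨x, hx.2, by simp [Finset.insert_subset_iff, haS, hx.1]⟩
      · left
        intro y hy
        obtain ⟨z, hz⟩ := hall y hy
        simp only [Finset.mem_inter, Finset.mem_insert, Finset.mem_singleton] at hz
        rcases hz with ⟨hz, rfl | rfl⟩
        · exact absurd hz haS
        · exact hz
    · rintro (hsub | ⟨x, hx, hsub⟩)
      · constructor
        · rw [Finset.inter_eq_right.2 hsub, ← Finset.card_pos, Finset.card_erase_of_mem ha]
          omega
        · exact fun y hy => ⟨y, by simp [hsub hy]⟩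
      · simp only [Finset.insert_subset_iff, Finset.singleton_subset_iff] at hsub
        exact ⟨⟨x, Finset.mem_inter.2 ⟨hsub.2, hx⟩⟩, fun y _ => ⟨a, by simp [hsub.1]⟩⟩
  ext B
  rw [mem_blocker_members, hcover]
  change _ ↔ B ∈ insert (C.ground.erase a) ((C.ground.erase a).image (fun x => {a, x}))
  rw [← hmem]
  constructor
  · rintro ⟨⟨hB, h'⟩, hmin⟩
    have : ∃ M ∈ C.members, M ⊆ B ∧ C.IsCover M := by
      rcases h' with h' | ⟨x, hx, h'⟩
      · exact ⟨_, by rw [hmem]; simp, h', (hcover _).2 ⟨Finset.erase_subset _ _, Or.inl subset_rfl⟩⟩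
      · exact ⟨{a, x}, by rw [hmem]; exact Finset.mem_insert_of_mem (Finset.mem_image_of_mem _ hx),
          h', (hcover _).2 ⟨h'.trans hB, Or.inr ⟨x, hx, subset_rfl⟩⟩⟩
    obtain ⟨M, hM, hMB, hMc⟩ := this
    rcases eq_or_ssubset_of_subset hMB with rfl | h''
    · exact hM
    · exact absurd hMc (hmin M h'')
  · intro hB
    refine ⟨⟨C.subset_ground B hB, ?_⟩, ?_⟩
    · rw [hmem, Finset.mem_insert, Finset.mem_image] at hB
      rcases hB with rfl | ⟨x, hx, rfl⟩
      · exact Or.inl subset_rfl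
      · exact Or.inr ⟨x, hx, subset_rfl⟩
    · intro S hS hSc
      have : ∃ M ∈ C.members, M ⊆ S := by
        rcases ((hcover S).1 hSc).2 with h' | ⟨x, hx, h'⟩
        · exact ⟨_, by rw [hmem]; simp, h'⟩
        · exact ⟨{a, x}, by rw [hmem]; exact Finset.mem_insert_of_mem (Finset.mem_image_of_mem _ hx),
            h'⟩
      obtain ⟨M, hM, hMS⟩ := this
      exact C.antichain hM hB (fun h => (h ▸ hMS.trans_ssubset hS).ne rfl) (hMS.trans hS.1)

/-- A forbidden configuration is realized as the blocker of the minor given by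
`exists_minor_isCover_iff`; `blocker_blocker` then identifies the minor itself as a delta or as the
blocker of an extended odd hole. -/
theorem IsClean.cleanFamily {C : Clutter α} (h : C.IsClean) : CleanFamily C.Meets where
  mono _ _ := Meets.mono
  no_delta := by
    intro T B u hu hcard huB hB hmin hsingle
    have hBne : B.Nonempty := Finset.card_pos.1 (by omega)
    have hsingleton : ∀ b ∈ B, ¬ C.Meets ({b} ∪ T) := by
      intro b hb
      refine hmin _ ((Finset.singleton_subset_iff.2 hb).ssubset_of_ne ?_)
      rintro rfl
      simp at hcard
    have hground : ∀ x ∈ insert u B, x ∈ C.ground ∧ x ∉ T := by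
      intro x hx
      -- An element outside the ground set or inside `T` is irrelevant to meeting the members, so
      -- dropping it would turn a pair into a forbidden singleton.
      by_contra hcon
      rcases Finset.mem_insert.1 hx with rfl | hxB
      · obtain ⟨b, hb⟩ := hBne
        refine hsingleton b hb ((meets_iff_of_inter_ground fun y hy => ?_).1 (huB b hb))
        have : y = x → y ∈ T := by rintro rfl; tauto
        simp only [Finset.mem_union, Finset.mem_insert, Finset.mem_singleton]
        tauto
      · refine hsingle ((meets_iff_of_inter_ground fun y hy => ?_).1 (huB x hxB))
        have : y = x → y ∈ T := by rintro rfl; tauto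
        simp only [Finset.mem_union, Finset.mem_insert, Finset.mem_singleton]
        tauto
    obtain ⟨D, hD, hDg, hDc⟩ := C.exists_minor_isCover_iff (X := insert u B) (T := T)
      (fun x hx => (hground x hx).1) (Finset.disjoint_left.2 fun x hx => (hground x hx).2)
    refine (h D hD).1 ?_
    rw [← D.blocker_blocker]
    refine IsDelta.blocker ⟨?_, u, ?_, ?_⟩
    · change 3 ≤ D.ground.card
      rw [hDg, Finset.card_insert_of_notMem hu]
      omega
    · change u ∈ D.ground
      simp [hDg]
    change D.blocker.members = insert (D.ground.erase u) ((D.ground.erase u).image fun x => {u, x})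
    rw [hDg, Finset.erase_insert hu]
    have hpair : ∀ b ∈ B, ({u, b} : Finset α) ⊆ insert u B := by
      intro b hb
      simp [Finset.insert_subset_iff, hb]
    have hsub : ∀ S ⊆ insert u B, D.IsCover S → B ⊆ S ∨ ∃ b ∈ B, {u, b} ⊆ S := by
      intro S hS hSc
      rw [hDc S hS] at hSc
      by_cases huS : u ∈ S
      · by_cases hSu : ∃ b ∈ B, b ∈ S
        · obtain ⟨b, hb, hbS⟩ := hSu
          exact Or.inr ⟨b, hb, by simp [Finset.insert_subset_iff, huS, hbS]⟩
        · refine absurd (Meets.mono ?_ hSc) hsingle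
          refine Finset.union_subset_union_left fun x hx => ?_
          rcases Finset.mem_insert.1 (hS hx) with rfl | hxB
          · simp
          · exact absurd ⟨x, hxB, hx⟩ hSu
      · left
        have hSB : S ⊆ B := fun x hx => (Finset.mem_insert.1 (hS hx)).resolve_left
          (fun hxu => huS (hxu ▸ hx))
        rcases eq_or_ssubset_of_subset hSB with rfl | h'
        · exact subset_rfl
        · exact absurd hSc (hmin S h')
    ext S
    rw [mem_blocker_members, Finset.mem_insert, Finset.mem_image]
    have hBc : D.IsCover B := (hDc B (Finset.subset_insert _ _)).2 hB
    have huc : ∀ b ∈ B, D.IsCover {u, b} := fun b hb => (hDc _ (hpair b hb)).2 (huB b hb)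
    constructor
    · rintro ⟨hSc, hSmin⟩
      rcases hsub S (hDg ▸ hSc.1) hSc with h' | ⟨b, hb, h'⟩
      · rcases eq_or_ssubset_of_subset h' with rfl | h''
        · exact Or.inl rfl
        · exact absurd hBc (hSmin B h'')
      · rcases eq_or_ssubset_of_subset h' with rfl | h''
        · exact Or.inr ⟨b, hb, rfl⟩
        · exact absurd (huc b hb) (hSmin _ h'')
    · rintro (rfl | ⟨b, hb, rfl⟩)
      · refine ⟨hBc, fun S' hS' hSc' => ?_⟩
        exact hmin S' hS' ((hDc S' (hS'.1.trans (Finset.subset_insert _ _))).1 hSc')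
      · refine ⟨huc b hb, fun S' hS' hSc' => ?_⟩
        rw [hDc S' (hS'.1.trans (hpair b hb))] at hSc'
        have hcases : S' ⊆ {u} ∨ S' ⊆ {b} := by
          by_contra! hcon
          refine hS'.2 ?_
          obtain ⟨x, hx, hxu⟩ := Finset.not_subset.1 hcon.1
          obtain ⟨y, hy, hyb⟩ := Finset.not_subset.1 hcon.2
          have h1 := hS'.1 hx
          have h2 := hS'.1 hy
          simp only [Finset.mem_insert, Finset.mem_singleton] at h1 h2 hxu hyb
          have hx' := h1.resolve_left hxu
          have hy' := h2.resolve_right hyb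
          subst hx' hy'
          simp [Finset.insert_subset_iff, hx, hy]
        rcases hcases with h' | h'
        · exact hsingle (hSc'.mono (Finset.union_subset_union_left h'))
        · exact hsingleton b hb (hSc'.mono (Finset.union_subset_union_left h'))
  no_hole := by
    intro T n a hn hodd hinj hedge hchord
    have : NeZero n := ⟨by omega⟩
    have : Fact (1 < n) := ⟨by omega⟩
    have hne : ∀ i, a i ≠ a (i + 1) := fun i hi => by simpa using hinj hi
    have hsingle : ∀ i, ¬ C.Meets ({a i} ∪ T) := by
      intro i hi
      -- The case `i = j` of the chord hypothesis excludes singletons, since a one-element set is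
      -- not an edge.
      obtain ⟨k, hk⟩ := hchord i i (by simpa using hi)
      have := congrArg Finset.card hk
      rw [Finset.card_pair (hne k)] at this
      simp at this
    have hground : ∀ i, a i ∈ C.ground ∧ a i ∉ T := by
      intro i
      by_contra hcon
      refine hsingle (i + 1) ((meets_iff_of_inter_ground fun y hy => ?_).1 (hedge i))
      have : y = a i → y ∈ T := by rintro rfl; tauto
      simp only [Finset.mem_union, Finset.mem_insert, Finset.mem_singleton]
      tauto
    obtain ⟨D, hD, hDg, hDc⟩ := C.exists_minor_isCover_iff (X := Finset.univ.image a) (T := T)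
      (by simpa [Finset.subset_iff] using fun i => (hground i).1)
      (by simpa [Finset.disjoint_left] using fun i => (hground i).2)
    refine (h D hD).2 ⟨D.blocker, ⟨n, a, hn, hodd, hinj, ?_, ?_⟩, D.blocker_blocker.symm⟩
    · change (D.ground : Set α) = _
      simp [hDg]
    have hcard2 : ∀ S, D.IsCover S → 2 ≤ S.card := by
      intro S hS
      have hSX : S ⊆ Finset.univ.image a := hDg ▸ hS.1
      rw [hDc S hSX] at hS
      by_contra! hlt
      have : S = ∅ ∨ ∃ x, S = {x} := by
        rcases (by omega : S.card = 0 ∨ S.card = 1) with h' | h'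
        · exact Or.inl (Finset.card_eq_zero.1 h')
        · exact Or.inr (Finset.card_eq_one.1 h')
      rcases this with rfl | ⟨x, rfl⟩
      · exact hsingle 0 (hS.mono (Finset.union_subset_union_left (Finset.empty_subset _)))
      · obtain ⟨i, -, rfl⟩ := Finset.mem_image.1 (hSX (Finset.mem_singleton_self x))
        exact hsingle i hS
    have hedgemem : ∀ i, {a i, a (i + 1)} ∈ D.blocker.members := by
      intro i
      refine mem_blocker_members.2 ⟨(hDc _ ?_).2 (hedge i), fun S hS hSc => ?_⟩
      · simp [Finset.insert_subset_iff]
      · have h1 := Finset.card_lt_card hS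
        rw [Finset.card_pair (hne i)] at h1
        exact absurd (hcard2 S hSc) (by omega)
    intro M
    constructor
    · rintro ⟨hM, hmin⟩
      have hMc := (mem_blocker_members.1 hM).1
      have h2 := hmin _ (hedgemem 0)
      rw [Finset.card_pair (hne 0)] at h2
      obtain ⟨x, y, -, rfl⟩ := Finset.card_eq_two.1 (le_antisymm h2 (hcard2 M hMc))
      have hMX : {x, y} ⊆ Finset.univ.image a := hDg ▸ hMc.1
      rw [hDc _ hMX] at hMc
      obtain ⟨i, -, rfl⟩ := Finset.mem_image.1 (hMX (Finset.mem_insert_self _ _))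
      obtain ⟨j, -, rfl⟩ := Finset.mem_image.1
        (hMX (Finset.mem_insert_of_mem (Finset.mem_singleton_self _)))
      exact hchord i j hMc
    · rintro ⟨i, rfl⟩
      refine ⟨hedgemem i, fun M' hM' => ?_⟩
      rw [Finset.card_pair (hne i)]
      exact hcard2 M' (mem_blocker_members.1 hM').1

/-! ### Incidences of the Fano plane -/

/-- The third point of the line of the Fano plane through two distinct points. -/
def fanoThird (x y : Fin 7) : Fin 7 :=
  (![![0, 2, 1, 4, 3, 6, 5], ![2, 0, 0, 6, 5, 4, 3], ![1, 0, 0, 5, 6, 3, 4],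
    ![4, 6, 5, 0, 0, 2, 1], ![3, 5, 6, 0, 0, 1, 2], ![6, 4, 3, 2, 1, 0, 0],
    ![5, 3, 4, 1, 2, 0, 0]] : Fin 7 → Fin 7 → Fin 7) x y

theorem fanoThird_comm : ∀ x y, fanoThird x y = fanoThird y x := by decide

set_option maxRecDepth 4000 in
theorem fanoThird_spec : ∀ x y, x ≠ y → fanoThird x y ≠ x ∧ fanoThird x y ≠ y ∧
    fanoThird x (fanoThird x y) = y ∧ {x, y, fanoThird x y} ∈ fanoLines := by decide

set_option maxRecDepth 20000 in
theorem exists_eq_of_mem_fanoLines : ∀ L ∈ fanoLines, ∃ x y z, x ≠ y ∧ z ∉ L ∧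
    L = {x, y, fanoThird x y} := by decide

set_option maxRecDepth 4000 in
-- Three non-collinear points generate the plane; the two equations identify the third points of the
-- remaining lines needed by `exists_of_config`.
theorem fanoThird_config : ∀ a p b, a ≠ p → a ≠ b → p ≠ b → b ≠ fanoThird a p →
    [a, p, fanoThird a p, b, fanoThird a b, fanoThird (fanoThird a p) b, fanoThird p b].Nodup ∧
      fanoThird a (fanoThird p b) = fanoThird (fanoThird a p) b ∧
      fanoThird (fanoThird a p) (fanoThird a b) = fanoThird p b := by decide

/-! ### Parity arguments along Fano lines -/

/-- A clean family together with seven pairs of sets, such that each set of the family intersects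
the seven unions of the sets `V i` along a line of the Fano plane and the sets `U i` off it, and
such that each `V i` lies in one side of a component of the graph of pairs on `U i ∪ V i`. -/
structure FanoFamily (P : Finset α → Prop) (U V : Fin 7 → Finset α) : Prop where
  clean : CleanFamily P
  index_unique : ∀ i j z, z ∈ U i ∪ V i → z ∈ U j ∪ V j → i = j
  disjoint : ∀ i z, z ∈ U i → z ∉ V i
  connected : ∀ (i : Fin 7) (P' : Finset α → Prop) (R : Set α), (∀ S, P S → P' S) →
    (∀ z ∈ U i ∪ V i, z ∈ R) → ∀ x ∈ V i, ∀ y ∈ V i, EvenConnected (pairGraph P' R) x y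
  meets : ∀ L ∈ fanoLines, ∀ S, P S → ∃ z ∈ S, ∃ i, i ∈ L ∧ z ∈ V i ∨ i ∉ L ∧ z ∈ U i

namespace FanoFamily

variable {P : Finset α → Prop} {U V : Fin 7 → Finset α}

theorem meets_of_union (h : FanoFamily P U V) {L : Finset (Fin 7)} (hL : L ∈ fanoLines)
    {S T : Finset α} (hT : ∀ z ∈ T, ∃ i ∉ L, z ∈ V i) (hP : P (S ∪ T)) :
    ∃ z ∈ S, ∃ i, i ∈ L ∧ z ∈ V i ∨ i ∉ L ∧ z ∈ U i := by
  obtain ⟨z, hz, i, hi⟩ := h.meets L hL _ hP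
  rcases Finset.mem_union.1 hz with hz | hz
  · exact ⟨z, hz, i, hi⟩
  · obtain ⟨j, hj, hzj⟩ := hT z hz
    have hij : i = j := h.index_unique i j z
      (by rcases hi with hi | hi <;> simp [hi.2]) (by simp [hzj])
    subst hij
    rcases hi with hi | hi
    · exact absurd hi.1 hj
    · exact absurd hzj (h.disjoint i z hi.2)

/-- Each line avoiding the contracted indices dictates the side of a new singleton; two lines that
disagree about `j` therefore exclude singletons of index `j`. -/
theorem mem_of_union_singleton (h : FanoFamily P U V) {L : Finset (Fin 7)} (hL : L ∈ fanoLines)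
    {T : Finset α} (hT : ∀ z ∈ T, ∃ i ∉ L, z ∈ V i) {z : α} (hP : P ({z} ∪ T)) {j : Fin 7}
    (hz : z ∈ U j ∪ V j) : j ∈ L ∧ z ∈ V j ∨ j ∉ L ∧ z ∈ U j := by
  obtain ⟨y, hy, i, hi⟩ := h.meets_of_union hL hT hP
  rw [Finset.mem_singleton] at hy
  subst hy
  have hij : i = j := h.index_unique i j y
    (by rcases hi with hi | hi <;> simp [hi.2]) hz
  rwa [hij] at hi

/-- If the union of the sets along a line is in the family, then one of the three sets can be
replaced with one of its elements. -/
theorem exists_good (h : FanoFamily P U V) {p b e : Fin 7} {L : Finset (Fin 7)}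
    (hL : L ∈ fanoLines) (hpL : p ∈ L) (hb : b ∉ L) (he : e ∉ L)
    (hP : P (V p ∪ (V b ∪ V e))) : ∃ v ∈ V p, P ({v} ∪ (V b ∪ V e)) := by
  have hT : ∀ z ∈ V b ∪ V e, ∃ i ∉ L, z ∈ V i := by
    intro z hz
    rcases Finset.mem_union.1 hz with hz | hz
    · exact ⟨b, hb, hz⟩
    · exact ⟨e, he, hz⟩
  have hne : (V p).Nonempty := by
    obtain ⟨z, hz, -⟩ := h.meets_of_union hL hT hP
    exact ⟨z, hz⟩
  by_contra! hcon
  obtain ⟨x, hx⟩ := id hne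
  -- After contracting `V b ∪ V e`, the line `L` excludes singletons in `U p`, and `hcon` those in
  -- `V p`; but `V p` is one-sided and in the contracted family.
  refine (h.clean.contract (V b ∪ V e)).not_of_evenConnected (R := {z | z ∈ U p ∪ V p}) ?_
    (fun z hz => by simp [hz]) hne (b := x) ?_ hP
  · intro z hz hPz
    rcases h.mem_of_union_singleton hL hT hPz hz with h' | h'
    · exact hcon z h'.2 hPz
    · exact h'.1 hpL
  · exact h.connected p _ _ (fun S hS => h.clean.mono _ _ Finset.subset_union_left hS)
      (fun z hz => hz) x hx

/-- Contract `A ∪ Q` and suppose that no singleton appears in `R`. The three covers through `a` or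
`p` put `V b` opposite `V c` and `V e`, and `V e` opposite `V d`. So `V b ∪ V d` and `V c ∪ V e` are
each one-sided, on opposite sides, yet the last two covers put `Z` opposite both. The sets `A`, `Q`,
`Z` are left free so that they can be whole sets `V i` or single elements. -/
theorem exists_of_config (h : FanoFamily P U V) (hV : ∀ i, (V i).Nonempty) {a p q b c d e : Fin 7}
    (hnodup : [a, p, q, b, c, d, e].Nodup) (hqbd : {q, b, d} ∈ fanoLines)
    (hqce : {q, c, e} ∈ fanoLines) {A Q Z : Finset α} {R : Set α} (hA : A ⊆ V a) (hQ : Q ⊆ V p)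
    (hZR : ∀ z ∈ Z, z ∈ R) {z₀ : α} (hz₀ : z₀ ∈ Z)
    (hZ : ∀ (P' : Finset α → Prop) (R' : Set α), (∀ S, P S → P' S) → (∀ z ∈ R, z ∈ R') →
      ∀ z ∈ Z, EvenConnected (pairGraph P' R') z₀ z)
    (habc : P (A ∪ (V b ∪ V c))) (hade : P (A ∪ (V e ∪ V d))) (hpbe : P (Q ∪ (V b ∪ V e)))
    (hPqbd : P (Z ∪ (V b ∪ V d))) (hPqce : P (Z ∪ (V c ∪ V e))) :
    ∃ z ∈ R, P ({z} ∪ (A ∪ Q)) := by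
  by_contra! hcon
  simp only [List.nodup_cons, List.mem_cons, List.not_mem_nil, or_false, not_or] at hnodup
  obtain ⟨⟨hap, haq, hab, hac, had, hae⟩, ⟨hpq, hpb, hpc, hpd, hpe⟩, ⟨hqb, hqc, hqd, hqe⟩,
    ⟨hbc, hbd, hbe⟩, ⟨hcd, hce⟩, hde, -⟩ := hnodup
  set T := A ∪ Q with hTdef
  have hT : ∀ L : Finset (Fin 7), a ∉ L → p ∉ L → ∀ z ∈ T, ∃ i ∉ L, z ∈ V i := by
    intro L haL hpL z hz
    rcases Finset.mem_union.1 hz with hz | hz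
    · exact ⟨a, haL, hA hz⟩
    · exact ⟨p, hpL, hQ hz⟩
  have hT1 := hT {q, b, d} (by simp [haq, hab, had]) (by simp [hpq, hpb, hpd])
  have hT2 := hT {q, c, e} (by simp [haq, hac, hae]) (by simp [hpq, hpc, hpe])
  have hPmono : ∀ S, P S → P (S ∪ T) := fun S hS => h.clean.mono _ _ Finset.subset_union_left hS
  let R' : Set α := {z | ∃ j ∈ ({b, c, d, e} : Finset (Fin 7)), z ∈ U j ∪ V j} ∪ R
  have hclean := h.clean.contract T
  -- The lines `{q, b, d}` and `{q, c, e}` avoid `a` and `p`, and each of `b, c, d, e` is on exactly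
  -- one of them.
  have hR' : ∀ z ∈ R', ¬ P ({z} ∪ T) := by
    rintro z (⟨j, hj, hz⟩ | hz) hP
    · have h1 := h.mem_of_union_singleton hqbd hT1 hP hz
      have h2 := h.mem_of_union_singleton hqce hT2 hP hz
      have h3 := h.disjoint j z
      simp only [Finset.mem_insert, Finset.mem_singleton] at hj h1 h2
      grind
    · exact hcon z hz hP
  have hVR : ∀ j ∈ ({b, c, d, e} : Finset (Fin 7)), ∀ z ∈ U j ∪ V j, z ∈ R' :=
    fun j hj z hz => Or.inl ⟨j, hj, hz⟩
  have hVR' : ∀ j ∈ ({b, c, d, e} : Finset (Fin 7)), ∀ z ∈ V j, z ∈ R' :=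
    fun j hj z hz => hVR j hj z (Finset.mem_union_right _ hz)
  have hconn : ∀ j ∈ ({b, c, d, e} : Finset (Fin 7)), ∀ x ∈ V j, ∀ y ∈ V j,
      EvenConnected (pairGraph (fun S => P (S ∪ T)) R') x y :=
    fun j hj => h.connected j _ _ hPmono (hVR j hj)
  have hpair : ∀ i ∈ ({b, c, d, e} : Finset (Fin 7)), ∀ j ∈ ({b, c, d, e} : Finset (Fin 7)),
      P (V i ∪ V j ∪ T) → ∀ x ∈ V i, ∀ y ∈ V j,
      OddConnected (pairGraph (fun S => P (S ∪ T)) R') x y := by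
    intro i hi j hj hP x hx y hy
    exact hclean.oddConnected_of_union hR' (hVR' i hi) (hVR' j hj) (hV i) (hV j)
      (hconn i hi x hx) (hconn j hj y hy) hP
  obtain ⟨vb, hvb⟩ := hV b
  obtain ⟨vc, hvc⟩ := hV c
  obtain ⟨vd, hvd⟩ := hV d
  obtain ⟨ve, hve⟩ := hV e
  have hobc := hpair b (by simp) c (by simp)
    (h.clean.mono _ _ (by rw [hTdef]; intro x; simp only [Finset.mem_union]; tauto) habc) vb hvb vc hvc
  have hoed := hpair e (by simp) d (by simp)
    (h.clean.mono _ _ (by rw [hTdef]; intro x; simp only [Finset.mem_union]; tauto) hade) ve hve vd hvd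
  have hobe := hpair b (by simp) e (by simp)
    (h.clean.mono _ _ (by rw [hTdef]; intro x; simp only [Finset.mem_union]; tauto) hpbe) vb hvb ve hve
  have hzZ := hZ (fun S => P (S ∪ T)) R' hPmono (fun z hz => Or.inr hz)
  have hside : ∀ i ∈ ({b, c, d, e} : Finset (Fin 7)), ∀ j ∈ ({b, c, d, e} : Finset (Fin 7)),
      P (Z ∪ (V i ∪ V j)) → ∀ x ∈ V i, ∀ y ∈ V j,
      EvenConnected (pairGraph (fun S => P (S ∪ T)) R') x y →
      OddConnected (pairGraph (fun S => P (S ∪ T)) R') z₀ x := by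
    intro i hi j hj hP x hx y hy hxy
    refine hclean.oddConnected_of_union hR' (fun z hz => Or.inr (hZR z hz)) (Y := V i ∪ V j) ?_
      ⟨z₀, hz₀⟩ ((hV i).mono Finset.subset_union_left) hzZ ?_ (hPmono _ hP)
    · intro z hz
      exact (Finset.mem_union.1 hz).elim (hVR' i hi z) (hVR' j hj z)
    · intro z hz
      rcases Finset.mem_union.1 hz with hz | hz
      · exact hconn i hi x hx z hz
      · exact hxy.trans (hconn j hj y hy z hz)
  have h1 := hside b (by simp) d (by simp) hPqbd vb hvb vd hvd (hobe.trans hoed)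
  have h2 := hside c (by simp) e (by simp) hPqce vc hvc ve hve (hobc.symm.trans hobe)
  exact hclean.not_evenConnected_of_oddConnected hR' (h1.symm.trans h2) hobc

/-- If an element is good for one line, then it is good for another one, provided that the four
lines that avoid its index are in the family. -/
theorem good_of_good (h : FanoFamily P U V) (hV : ∀ i, (V i).Nonempty) {a p b : Fin 7}
    (hap : a ≠ p) (hab : a ≠ b) (hpb : p ≠ b) (hb : b ≠ fanoThird a p)
    (hline : ∀ x y, x ≠ y → p ∉ ({x, y, fanoThird x y} : Finset (Fin 7)) →
      P (V x ∪ (V y ∪ V (fanoThird x y)))) {v : α} (hv : v ∈ V p)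
    (hgood : P ({v} ∪ (V b ∪ V (fanoThird p b)))) :
    P ({v} ∪ (V a ∪ V (fanoThird p a))) := by
  obtain ⟨hnodup, had, hqc⟩ := fanoThird_config a p b hap hab hpb hb
  have hnodup' := hnodup
  simp only [List.nodup_cons, List.mem_cons, List.not_mem_nil, or_false, not_or] at hnodup'
  obtain ⟨⟨-, haq, -, hac, had', hae⟩, ⟨hpq, -, hpc, hpd, hpe⟩, ⟨hqb, hqc', hqd, hqe⟩, -⟩ := hnodup'
  have hqbd := (fanoThird_spec _ _ hqb).2.2.2
  have hqce := (fanoThird_spec _ _ hqc').2.2.2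
  rw [hqc] at hqce
  obtain ⟨z₀, hz₀⟩ := hV (fanoThird a p)
  obtain ⟨z, hz, hP⟩ := h.exists_of_config hV hnodup hqbd hqce (A := V a) (Q := {v})
    (Z := V (fanoThird a p)) (R := {z | z ∈ U (fanoThird a p) ∪ V (fanoThird a p)}) subset_rfl
    (by simpa using hv) (fun z hz => Finset.mem_union_right _ hz) hz₀
    (fun P' R' hP' hR' => h.connected _ P' R' hP' hR' z₀ hz₀)
    (hline a b hab (by simp [hap.symm, hpb, hpc]))
    (by simpa only [had] using hline a (fanoThird p b) hae (by simp [hap.symm, hpe, had, hpd]))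
    hgood (hline _ _ hqb (by simp [hpq, hpb, hpd]))
    (by simpa only [hqc] using hline _ _ hqc' (by simp [hpq, hpc, hqc, hpe]))
  -- The element found could a priori be in `U`; a line through its index that avoids `a` and `p`
  -- rules this out.
  have hzV : z ∈ V (fanoThird a p) := by
    have hT : ∀ y ∈ V a ∪ {v}, ∃ i ∉ ({fanoThird a p, b, fanoThird (fanoThird a p) b} :
        Finset (Fin 7)), y ∈ V i := by
      intro y hy
      rcases Finset.mem_union.1 hy with hy | hy
      · exact ⟨a, by simp [haq, hab, had'], hy⟩
      · rw [Finset.mem_singleton] at hy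
        exact ⟨p, by simp [hpq, hpb, hpd], hy ▸ hv⟩
    rcases h.mem_of_union_singleton hqbd hT hP hz with h' | h'
    · exact h'.2
    · simp at h'
  refine h.clean.mono _ _ ?_ hP
  rw [fanoThird_comm p a]
  intro y
  have : y = z → y ∈ V (fanoThird a p) := by rintro rfl; exact hzV
  simp only [Finset.mem_union, Finset.mem_singleton]
  tauto

/-- Of two lines through `p`, at least one is in the family; the other serves as the test line `L`
of `exists_good`. -/
theorem exists_good_of_lines (h : FanoFamily P U V)
    (hline : {L | L ∈ fanoLines ∧ ¬ P (L.biUnion V)}.Subsingleton) (p : Fin 7) :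
    ∃ v ∈ V p, ∃ b, p ≠ b ∧ P ({v} ∪ (V b ∪ V (fanoThird p b))) := by
  have key : ∀ p : Fin 7, ∃ a b, p ≠ a ∧ p ≠ b ∧ a ∉ ({p, b, fanoThird p b} : Finset (Fin 7)) ∧
      b ∉ ({p, a, fanoThird p a} : Finset (Fin 7)) ∧
      fanoThird p b ∉ ({p, a, fanoThird p a} : Finset (Fin 7)) ∧
      fanoThird p a ∉ ({p, b, fanoThird p b} : Finset (Fin 7)) := by decide
  obtain ⟨a, b, hpa, hpb, hab, hba, hbe, heb⟩ := key p
  have hsplit : ∀ b, ({p, b, fanoThird p b} : Finset (Fin 7)).biUnion V =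
      V p ∪ (V b ∪ V (fanoThird p b)) := by intro b; simp
  have hLa := (fanoThird_spec p a hpa).2.2.2
  have hLb := (fanoThird_spec p b hpb).2.2.2
  by_cases hPb : P (({p, b, fanoThird p b} : Finset (Fin 7)).biUnion V)
  · rw [hsplit] at hPb
    obtain ⟨v, hv, hP⟩ := h.exists_good hLa (by simp) hba hbe hPb
    exact ⟨v, hv, b, hpb, hP⟩
  · have hPa : P (({p, a, fanoThird p a} : Finset (Fin 7)).biUnion V) := by
      by_contra hPa
      have := hline ⟨hLa, hPa⟩ ⟨hLb, hPb⟩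
      exact hab (this ▸ by simp)
    rw [hsplit] at hPa
    obtain ⟨v, hv, hP⟩ := h.exists_good hLb (by simp) hab heb hPa
    exact ⟨v, hv, a, hpa, hP⟩

/-- If the line of `x` and `y` were the exception, the lines avoiding `y` and any other line through
`y` would be in the family. A good element of `V y` for such a line is transferred by `good_of_good`
to the exceptional line. -/
theorem forall_lines (h : FanoFamily P U V)
    (hline : {L | L ∈ fanoLines ∧ ¬ P (L.biUnion V)}.Subsingleton) (x y : Fin 7) (hxy : x ≠ y) :
    P (V x ∪ (V y ∪ V (fanoThird x y))) := by
  have hsplit : ∀ x y, ({x, y, fanoThird x y} : Finset (Fin 7)).biUnion V =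
      V x ∪ (V y ∪ V (fanoThird x y)) := by intro x y; simp
  have hV : ∀ i, (V i).Nonempty := fun i =>
    (h.exists_good_of_lines hline i).elim fun v hv => ⟨v, hv.1⟩
  by_contra hcon
  rw [← hsplit] at hcon
  have hL := (fanoThird_spec x y hxy).2.2.2
  have hother : ∀ x' y', x' ≠ y' → y ∉ ({x', y', fanoThird x' y'} : Finset (Fin 7)) →
      P (V x' ∪ (V y' ∪ V (fanoThird x' y'))) := by
    intro x' y' hxy' hy
    rw [← hsplit]
    by_contra hcon'
    refine hy ?_
    rw [hline ⟨(fanoThird_spec x' y' hxy').2.2.2, hcon'⟩ ⟨hL, hcon⟩]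
    simp
  have key : ∀ x y : Fin 7, x ≠ y → ∃ b, x ≠ b ∧ y ≠ b ∧ b ≠ fanoThird x y ∧
      x ∉ ({y, b, fanoThird y b} : Finset (Fin 7)) ∧
      b ∉ ({x, y, fanoThird x y} : Finset (Fin 7)) ∧
      fanoThird y b ∉ ({x, y, fanoThird x y} : Finset (Fin 7)) := by decide
  obtain ⟨b, hxb, hyb, hb, hxL, hbL, heL⟩ := key x y hxy
  have hPb : P (V y ∪ (V b ∪ V (fanoThird y b))) := by
    rw [← hsplit]
    by_contra hcon'
    refine hxL ?_
    rw [hline ⟨(fanoThird_spec y b hyb).2.2.2, hcon'⟩ ⟨hL, hcon⟩]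
    simp
  obtain ⟨v, hv, hP⟩ := h.exists_good hL (by simp) hbL heL hPb
  have := h.good_of_good hV hxy hxb hyb hb hother hv hP
  refine hcon (h.clean.mono _ _ ?_ this)
  rw [hsplit, fanoThird_comm y x]
  intro z
  have : z = v → z ∈ V y := by rintro rfl; exact hv
  simp only [Finset.mem_union, Finset.mem_singleton]
  tauto

theorem exists_transversal (h : FanoFamily P U V)
    (hline : {L | L ∈ fanoLines ∧ ¬ P (L.biUnion V)}.Subsingleton) :
    ∃ v : Fin 7 → α, (∀ i, v i ∈ V i) ∧ ∀ L ∈ fanoLines, P (L.image v) := by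
  have hall := h.forall_lines hline
  have hV : ∀ i, (V i).Nonempty := fun i =>
    (h.exists_good_of_lines hline i).elim fun v hv => ⟨v, hv.1⟩
  have hex : ∀ p, ∃ v ∈ V p, ∀ a, p ≠ a → P ({v} ∪ (V a ∪ V (fanoThird p a))) := by
    intro p
    obtain ⟨v, hv, b, hpb, hP⟩ := h.exists_good_of_lines hline p
    refine ⟨v, hv, fun a hpa => ?_⟩
    -- If `a` is on the line of `p` and `b`, the claim is `hP` up to order; `good_of_good` handles
    -- the other lines.
    rcases eq_or_ne a b with rfl | hab
    · exact hP
    rcases eq_or_ne b (fanoThird p a) with rfl | hb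
    · rwa [(fanoThird_spec p a hpa).2.2.1, Finset.union_comm (V _)] at hP
    · exact h.good_of_good hV hpa.symm hab hpb (by rwa [fanoThird_comm])
        (fun x y hxy _ => hall x y hxy) hv hP
  choose v hv hgood using hex
  refine ⟨v, hv, fun L hL => ?_⟩
  obtain ⟨a, p, b, hap, hbL, rfl⟩ := exists_eq_of_mem_fanoLines L hL
  simp only [Finset.mem_insert, Finset.mem_singleton, not_or] at hbL
  obtain ⟨hba, hbp, hbq⟩ := hbL
  have hab : a ≠ b := Ne.symm hba
  have hpb : p ≠ b := Ne.symm hbp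
  obtain ⟨hnodup, had, hqc⟩ := fanoThird_config a p b hap hab hpb hbq
  have hnodup' := hnodup
  simp only [List.nodup_cons, List.mem_cons, List.not_mem_nil, or_false, not_or] at hnodup'
  obtain ⟨⟨-, -, -, -, -, hae⟩, -, ⟨hqb, hqc', -⟩, -⟩ := hnodup'
  have hqbd := (fanoThird_spec _ _ hqb).2.2.2
  have hqce := (fanoThird_spec _ _ hqc').2.2.2
  rw [hqc] at hqce
  -- With `Z` and `R` both a single point, the completing element can only be the chosen one.
  obtain ⟨z, rfl, hP⟩ := h.exists_of_config hV hnodup hqbd hqce (A := {v a}) (Q := {v p})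
    (Z := {v (fanoThird a p)}) (R := {v (fanoThird a p)}) (by simpa using hv a)
    (by simpa using hv p) (by simp)
    (z₀ := v (fanoThird a p)) (by simp)
    (fun P' R' _ _ z hz => by rw [Finset.mem_singleton.1 hz]; exact .refl _)
    (hgood a b hab) (by simpa only [had] using hgood a _ hae) (hgood p b hpb)
    (hgood _ b hqb) (by simpa only [hqc] using hgood _ _ hqc')
  convert hP using 1
  ext z
  simp only [Finset.mem_image, Finset.mem_insert, Finset.mem_singleton, Finset.mem_union]
  constructor
  · rintro ⟨i, rfl | rfl | rfl, rfl⟩ <;> tauto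
  · rintro (rfl | rfl | rfl)
    exacts [⟨_, by simp, rfl⟩, ⟨_, by simp, rfl⟩, ⟨_, by simp, rfl⟩]

end FanoFamily

/-! ### From the clutter to the Fano minor -/

/-- Every edge of `coverGraph` is a pair in the family and switches sides, so the parity of the
length records whether the ends share a side. -/
theorem IsComponentBipartition.exists_walk {C : Clutter α} {c : C.coverGraph.ConnectedComponent}
    {U W : Finset α} (h : C.IsComponentBipartition c U W) {P : Finset α → Prop} {R : Set α}
    (hP : ∀ S, C.Meets S → P S) (hR : ∀ z ∈ U ∪ W, z ∈ R) {x y : {x : α // x ∈ C.ground}}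
    (w : C.coverGraph.Walk x y) (hx : x ∈ c.supp) :
    ∃ p : (pairGraph P R).Walk x.1 y.1, (Even p.length ↔ (x.1 ∈ W ↔ y.1 ∈ W)) := by
  induction w with
  | nil => exact ⟨.nil, by simp⟩
  | @cons x t y hadj w ih =>
    obtain ⟨p, hp⟩ := ih (SimpleGraph.ConnectedComponent.mem_supp_of_adj_mem_supp c hx hadj)
    have hside := h.2.2 x t hx hadj
    have hdisj := fun z (hzU : z ∈ U) (hzW : z ∈ W) => Finset.disjoint_left.1 h.1 hzU hzW
    have hadj' : (pairGraph P R).Adj x.1 t.1 := by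
      refine ⟨fun h' => hadj.1 (Subtype.ext h'), hR _ ?_, hR _ ?_, hP _ hadj.2.1.2⟩
      · rw [Finset.mem_union]; tauto
      · rw [Finset.mem_union]; tauto
    refine ⟨.cons hadj' p, ?_⟩
    rw [SimpleGraph.Walk.length_cons, Nat.even_add_one, hp]
    have h1 := hdisj x.1
    have h2 := hdisj t.1
    tauto

theorem IsClean.fanoFamily {C : Clutter α} (hclean : C.IsClean)
    (comp : Fin 7 ≃ C.coverGraph.ConnectedComponent) {U V : Fin 7 → Finset α}
    (hUV : ∀ i : Fin 7, C.IsComponentBipartition (comp i) (U i) (V i))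
    (hmember : ∀ L ∈ fanoLines, ∃ M ∈ C.members, M ⊆ (Lᶜ).biUnion U ∪ L.biUnion V) :
    FanoFamily C.Meets U V where
  clean := hclean.cleanFamily
  index_unique := by
    intro i j z hi hj
    rw [← Finset.mem_coe, (hUV i).2.1] at hi
    rw [← Finset.mem_coe, (hUV j).2.1] at hj
    obtain ⟨x, hx, rfl⟩ := hi
    obtain ⟨y, hy, hxy⟩ := hj
    obtain rfl : y = x := Subtype.ext hxy
    rw [SimpleGraph.ConnectedComponent.mem_supp_iff] at hx hy
    exact comp.injective (hx.symm.trans hy)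
  disjoint i z := fun h => Finset.disjoint_left.1 (hUV i).1 h
  connected := by
    intro i P R hP hR x hx y hy
    have hx' : x ∈ Subtype.val '' (comp i).supp := by
      rw [← (hUV i).2.1]; simp [hx]
    have hy' : y ∈ Subtype.val '' (comp i).supp := by
      rw [← (hUV i).2.1]; simp [hy]
    obtain ⟨x, hxc, rfl⟩ := hx'
    obtain ⟨y, hyc, rfl⟩ := hy'
    rw [SimpleGraph.ConnectedComponent.mem_supp_iff] at hyc
    have hreach : C.coverGraph.Reachable x y := by
      rw [← SimpleGraph.ConnectedComponent.eq, hyc]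
      exact hxc
    obtain ⟨w⟩ := hreach
    obtain ⟨p, hp⟩ := (hUV i).exists_walk hP hR w hxc
    exact ⟨p, hp.2 (iff_of_true hx hy)⟩
  meets := by
    intro L hL S hS
    obtain ⟨M, hM, hMsub⟩ := hmember L hL
    obtain ⟨z, hz⟩ := hS M hM
    rw [Finset.mem_inter] at hz
    refine ⟨z, hz.1, ?_⟩
    have := hMsub hz.2
    simp only [Finset.mem_union, Finset.mem_biUnion, Finset.mem_compl] at this
    rcases this with ⟨i, hi⟩ | ⟨i, hi⟩
    · exact ⟨i, Or.inr hi⟩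
    · exact ⟨i, Or.inl hi⟩

set_option maxRecDepth 20000 in
/-- The clutter of the lines of the Fano plane is self-blocking. -/
theorem exists_fanoLine_subset : ∀ S : Finset (Fin 7),
    (∀ L ∈ fanoLines, (L ∩ S).Nonempty) → ∃ L ∈ fanoLines, L ⊆ S := by
  decide

end Clutter

theorem mainTheorem12 {α : Type*} [DecidableEq α] (C : Clutter α)
    (hclean : C.IsClean) (htangled : C.IsTangled)
    (hrank : C.rank = 7)
    (comp : Fin 7 ≃ C.coverGraph.ConnectedComponent)
    (U V : Fin 7 → Finset α)
    (hUV : ∀ i : Fin 7, C.IsComponentBipartition (comp i) (U i) (V i))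
    (hmember : ∀ L ∈ Clutter.fanoLines,
      ∃ M ∈ C.members, M ⊆ (Lᶜ).biUnion U ∪ L.biUnion V)
    (hcover : {L | L ∈ Clutter.fanoLines ∧ ¬ C.IsCover (L.biUnion V)}.Subsingleton) :
    C.HasL7Minor := by
  open Clutter in
  have hF := hclean.fanoFamily comp hUV hmember
  obtain ⟨v, hvV, hv⟩ := hF.exists_transversal
    (hcover.anti fun L hL => ⟨hL.1, fun h' => hL.2 h'.2⟩)
  have hinj : Function.Injective v := fun i j hij =>
    hF.index_unique i j (v i) (by simp [hvV]) (by simp [hij, hvV])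
  have hground : ∀ i, v i ∈ C.ground := by
    intro i
    have h : v i ∈ Subtype.val '' (comp i).supp := by
      rw [← (hUV i).2.1]; simp [hvV]
    obtain ⟨x, -, hx⟩ := h
    exact hx ▸ x.2
  have hJ : ∀ x ∈ C.ground, x ∉ C.ground \ Finset.univ.image v ↔ ∃ i, v i = x := by
    intro x hx
    simp [hx]
  set J := C.ground \ Finset.univ.image v with hJdef
  -- The trace of a member on the transversal meets every line, hence contains a line by
  -- self-blocking.
  have hline : ∀ M ∈ C.members, ∃ L ∈ fanoLines, L.image v ⊆ M \ J := by
    intro M hM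
    obtain ⟨L, hL, hLS⟩ := exists_fanoLine_subset (Finset.univ.filter fun i => v i ∈ M) (by
      intro L hL
      obtain ⟨x, hx⟩ := hv L hL M hM
      rw [Finset.mem_inter, Finset.mem_image] at hx
      obtain ⟨⟨i, hi, rfl⟩, hiM⟩ := hx
      exact ⟨i, by simp [hi, hiM]⟩)
    refine ⟨L, hL, fun x hx => ?_⟩
    obtain ⟨i, hi, rfl⟩ := Finset.mem_image.1 hx
    exact Finset.mem_sdiff.2 ⟨(Finset.mem_filter.1 (hLS hi)).2, (hJ _ (hground i)).2 ⟨i, rfl⟩⟩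
  have hanti : ∀ L ∈ fanoLines, ∀ L' ∈ fanoLines, L'.image v ⊆ L.image v → L' = L := by
    intro L hL L' hL' hsub
    rw [Finset.image_subset_image_iff hinj] at hsub
    by_contra hne
    exact L7.antichain hL' hL hne hsub
  have hpre : ∀ N, N ∈ C.preMinor ∅ J ↔ ∃ M ∈ C.members, M \ J = N := by
    intro N
    simp [preMinor]
  -- As `v i ∈ V i`, the member supplied for `L` meets the transversal only at indices in `L`; its
  -- trace also contains a line, which must be `L`.
  have hmem : ∀ L ∈ fanoLines, L.image v ∈ C.preMinor ∅ J := by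
    intro L hL
    obtain ⟨M, hM, hMsub⟩ := hmember L hL
    obtain ⟨L', hL', hsub⟩ := hline M hM
    have hML : M \ J ⊆ L.image v := by
      intro x hx
      rw [Finset.mem_sdiff] at hx
      obtain ⟨i, rfl⟩ := (hJ x (C.subset_ground M hM hx.1)).1 hx.2
      refine Finset.mem_image_of_mem v ?_
      have := hMsub hx.1
      simp only [Finset.mem_union, Finset.mem_biUnion, Finset.mem_compl] at this
      rcases this with ⟨j, hj, hij⟩ | ⟨j, hj, hij⟩
      · obtain rfl := hF.index_unique i j (v i) (by simp [hvV]) (by simp [hij])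
        exact absurd (hvV i) (hF.disjoint i _ hij)
      · obtain rfl := hF.index_unique i j (v i) (by simp [hvV]) (by simp [hij])
        exact hj
    obtain rfl := hanti L hL L' hL' (hsub.trans hML)
    exact (hpre _).2 ⟨M, hM, hML.antisymm hsub⟩
  refine ⟨C.minor ∅ J, ⟨∅, J, by simp, Finset.sdiff_subset, by simp, rfl⟩, v, hinj.injOn, ?_, ?_⟩
  · change C.ground \ (∅ ∪ J) = Finset.univ.image v
    rw [Finset.empty_union, hJdef, Finset.sdiff_sdiff_eq_self]
    simpa [Finset.subset_iff] using hground
  · change _ = fanoLines.image _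
    ext N
    simp only [minor, Finset.mem_filter, Finset.mem_image]
    constructor
    · rintro ⟨hN, hmin⟩
      obtain ⟨M, hM, rfl⟩ := (hpre N).1 hN
      obtain ⟨L, hL, hsub⟩ := hline M hM
      exact ⟨L, hL, hsub.antisymm (hmin.2 (hmem L hL) hsub)⟩
    · rintro ⟨L, hL, rfl⟩
      refine ⟨hmem L hL, hmem L hL, fun N hN hsub => ?_⟩
      obtain ⟨M, hM, rfl⟩ := (hpre N).1 hN
      obtain ⟨L', hL', hsub'⟩ := hline M hM
      obtain rfl := hanti L hL L' hL' (hsub'.trans hsub)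
      exact hsub'
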